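/- Let $\Gamma=\mathrm{SL}(2,\mathbb Z)$, and let $\Gamma\backslash\mathrm{SL}(2,\mathbb R)$ be the space of cosets $\Gamma g$ with the quotient topology. For $t\in\mathbb R$ let $a_t=\begin{pmatrix}e^{-t/2}&0\\0&e^{t/2}\end{pmatrix}$, acting on this space by right multiplication, and for $x\in\mathbb R$ let $\Gamma_x=\Gamma\begin{pmatrix}1&x\\0&1\end{pmatrix}$. A neighbourhood of the cusp is a subset of $\Gamma\backslash\mathrm{SL}(2,\mathbb R)$ whose complement is relatively compact. For such a neighbourhood $U$ and $T>0$ put $$I_T(U)=\frac1T\,\bigl|\{t\in[0,T]:\Gamma_xa_t\in U\}\bigr|,$$ where $|\cdot|$ is (outer) Lebesgue measure. The orbit $\{\Gamma_xa_t\}_{t\ge0}$ visits the cusp with frequency $0$ if $I_T(U)\to0$ as $T\to\infty$ for some neighbourhood $U$ of the cusp, and with frequency $1$ if $I_T(U)\to1$ as $T\to\infty$ for every neighbourhood $U$ of the cusp. Let $x$ be an irrational real number with classical (regular) continued fraction expansion $[a_0,a_1,a_2,\dots]$. For $\xi>1$ and $j\ge1$ let $a_j^\xi=a_j$ if $a_j>\xi$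 and $a_j^\xi=1$ if $a_j\le\xi$, and put $$A_N^\xi=\frac1N\sum_{j=1}^N\log a_j^\xi,\qquad A_N=\frac1N\sum_{j=1}^N\log a_j .$$ Then: 1. $\{\Gamma_xa_t\}_{t\ge0}$ visits the cusp with frequency $0$ if and only if $A_N^\xi\to0$ as $N\to\infty$ for some $\xi>1$. 2. $\{\Gamma_xa_t\}_{t\ge0}$ visits the cusp with frequency $1$ if and only if $A_N\to\infty$ as $N\to\infty$. If $x$ is rational (so that its continued fraction is finite), then $\{\Gamma_xa_t\}_{t\ge0}$ visits the cusp with frequency $1$, and not with frequency $0$. -/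

import Mathlib

open Filter Topology MeasureTheory
open scoped MatrixGroups

noncomputable section

/-- `Γ = SL(2, ℤ)`, as a subgroup of `SL(2, ℝ)`. -/
def integerSL2 : Subgroup SL(2, ℝ) :=
  (Matrix.SpecialLinearGroup.map (n := Fin 2) (Int.castRingHom ℝ)).range

/-- The homogeneous space `SL(2, ℤ) \ SL(2, ℝ)` of cosets `Γ g`, with the quotient topology. -/
abbrev ModularSpace : Type := Quotient (QuotientGroup.rightRel integerSL2)

/-- The coset `Γ g`. -/
def modularCoset (g : SL(2, ℝ)) : ModularSpace := Quotient.mk _ g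

/-- `a_t = diag (e^{-t/2}, e^{t/2})`. -/
def diagFlow (t : ℝ) : SL(2, ℝ) :=
  ⟨!![Real.exp (-t / 2), 0; 0, Real.exp (t / 2)], by
    rw [Matrix.det_fin_two_of, ← Real.exp_add]
    ring_nf
    simp⟩

/-- The unipotent matrix with rows `(1, x)` and `(0, 1)`. -/
def unipotent (x : ℝ) : SL(2, ℝ) :=
  ⟨!![1, x; 0, 1], by simp [Matrix.det_fin_two_of]⟩

/-- Right multiplication on the space of cosets: `(Γ g) h = Γ (g h)`. -/
def ModularSpace.rightMul (p : ModularSpace) (h : SL(2, ℝ)) : ModularSpace :=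
  Quotient.map (· * h) (fun a b hab => by
    have hab' : QuotientGroup.rightRel integerSL2 a b := hab
    change QuotientGroup.rightRel integerSL2 (a * h) (b * h)
    rw [QuotientGroup.rightRel_apply] at hab' ⊢
    simpa [mul_assoc] using hab') p

/-- The orbit `t ↦ Γ_x a_t`, where `Γ_x = Γ (1 x; 0 1)`. -/
def cuspOrbit (x t : ℝ) : ModularSpace :=
  (modularCoset (unipotent x)).rightMul (diagFlow t)

/-- Neighbourhoods of the cusp (the only end of the space): the sets whose complement is
relatively compact. -/
def IsCuspNhd (U : Set ModularSpace) : Prop := U ∈ cocompact ModularSpace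

/-- The proportion `I_T` of the time interval `[0, T]` that the orbit of `Γ_x` spends in `U`. -/
def visitProportion (x : ℝ) (U : Set ModularSpace) (T : ℝ) : ℝ :=
  (volume {t : ℝ | t ∈ Set.Icc 0 T ∧ cuspOrbit x t ∈ U}).toReal / T

def VisitsCuspWithFrequencyZero (x : ℝ) : Prop :=
  ∃ U : Set ModularSpace, IsCuspNhd U ∧ Tendsto (visitProportion x U) atTop (𝓝 0)

def VisitsCuspWithFrequencyOne (x : ℝ) : Prop :=
  ∀ U : Set ModularSpace, IsCuspNhd U → Tendsto (visitProportion x U) atTop (𝓝 1)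

/-- The partial quotients `a_0, a_1, …` of the classical continued fraction of `x`. The default
value `0` occurs only after the expansion has stopped, hence never for irrational `x`. -/
def partialQuotient (x : ℝ) : ℕ → ℝ
  | 0 => (GenContFract.of x).h
  | j + 1 => ((GenContFract.of x).partDens.get? j).getD 0

open Classical in
/-- `a_j^ξ`, which is `a_j` if `a_j > ξ` and `1` otherwise. -/
def modifiedPartialQuotient (x ξ : ℝ) (j : ℕ) : ℝ :=
  if ξ < partialQuotient x j then partialQuotient x j else 1

/-- `A_N = (1/N) ∑_{j=1}^N log a_j`. -/
def logAverage (x : ℝ) (N : ℕ) : ℝ :=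
  (1 / (N : ℝ)) * ∑ j ∈ Finset.Icc 1 N, Real.log (partialQuotient x j)

/-- `A_N^ξ = (1/N) ∑_{j=1}^N log a_j^ξ`. -/
def modifiedLogAverage (x ξ : ℝ) (N : ℕ) : ℝ :=
  (1 / (N : ℝ)) * ∑ j ∈ Finset.Icc 1 N, Real.log (modifiedPartialQuotient x ξ j)

end

/-!
By Mahler's criterion, the cosets `Γ g` whose lattice `ℤ² g` has a nonzero vector of norm less than
`ε` form a basis of neighbourhoods of the cusp as `ε → 0`. The lattice of `Γ_x a_t` consists of the
vectors `(m e^{-t/2}, (m x + n) e^{t/2})`. For `t` between the consecutive times `2 log q_k` and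
`2 log q_{k+1}`, where `q_k` are the denominators of the convergents of `x`, only the vector
belonging to the `k`-th convergent can be short, and since `‖q_k x‖` is comparable to `1 / q_{k+1}`
it is short on the whole interval, except for a bounded time near the two end points. Hence the
time spent near the cusp up to time `2 log q_N` is the total excess of the first `N` gaps over a
constant. As a gap is `2 log a_{k+1} + O(1)`, and as two successive gaps sum to at least `2 log 2`,
both frequencies can be read off the partial quotients. For rational `x = p / q` the vector coming
from `(m, n) = (q, -p)` tends to `0`, so that the orbit diverges.
-/

/-! ### Mahler's criterion -/

theorem modularCoset_eq_iff {g h : SL(2, ℝ)} :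
    modularCoset g = modularCoset h ↔ ∃ γ : SL(2, ℤ), h = (γ : SL(2, ℝ)) * g := by
  rw [modularCoset, modularCoset, Quotient.eq, QuotientGroup.rightRel_apply]
  exact exists_congr fun γ ↦ eq_mul_inv_iff_mul_eq.trans eq_comm

theorem isOpenQuotientMap_modularCoset : IsOpenQuotientMap modularCoset :=
  MulAction.isOpenQuotientMap_quotientMk

section ShortVectors

variable {n : Type*} [Fintype n] [DecidableEq n]

/-- The lattice `ℤⁿ g` of integer combinations of the rows of `g` has a nonzero vector of sup norm
less than `ε`. -/
def HasShortVector (ε : ℝ) (g : Matrix.SpecialLinearGroup n ℝ) : Prop :=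
  ∃ v : n → ℤ, v ≠ 0 ∧ ‖Matrix.vecMul (fun i ↦ (v i : ℝ)) g.1‖ < ε

theorem HasShortVector.mono {ε δ : ℝ} (h : ε ≤ δ) {g : Matrix.SpecialLinearGroup n ℝ}
    (hg : HasShortVector ε g) : HasShortVector δ g :=
  let ⟨v, hv, hlt⟩ := hg
  ⟨v, hv, hlt.trans_le h⟩

theorem HasShortVector.of_intCast_mul {ε : ℝ} {γ : Matrix.SpecialLinearGroup n ℤ}
    {g : Matrix.SpecialLinearGroup n ℝ}
    (h : HasShortVector ε ((γ : Matrix.SpecialLinearGroup n ℝ) * g)) : HasShortVector ε g := by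
  obtain ⟨v, hv, hlt⟩ := h
  refine ⟨Matrix.vecMul v γ.1, fun h0 ↦ hv ?_, ?_⟩
  · have hγ : γ.1 * (γ⁻¹).1 = 1 := by
      rw [← Matrix.SpecialLinearGroup.coe_mul, mul_inv_cancel, Matrix.SpecialLinearGroup.coe_one]
    rw [← Matrix.vecMul_one v, ← hγ, ← Matrix.vecMul_vecMul, h0, Matrix.zero_vecMul]
  · convert! hlt using 2
    rw [Matrix.SpecialLinearGroup.coe_mul, ← Matrix.vecMul_vecMul]
    congr 1
    ext j
    simp [Matrix.vecMul, dotProduct]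

theorem hasShortVector_intCast_mul_iff {ε : ℝ} (γ : Matrix.SpecialLinearGroup n ℤ)
    {g : Matrix.SpecialLinearGroup n ℝ} :
    HasShortVector ε ((γ : Matrix.SpecialLinearGroup n ℝ) * g) ↔ HasShortVector ε g := by
  refine ⟨.of_intCast_mul, fun h ↦ .of_intCast_mul (γ := γ⁻¹) ?_⟩
  rwa [← mul_assoc, ← map_mul, inv_mul_cancel, map_one, one_mul]

/-- Bound an entry of `v = (v g) g⁻¹`. -/
theorem HasShortVector.one_le_mul {ε C : ℝ} {g : Matrix.SpecialLinearGroup n ℝ}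
    (h : HasShortVector ε g) (hC : ∀ i j, |g⁻¹ i j| ≤ C) :
    1 ≤ Fintype.card n * (ε * C) := by
  obtain ⟨v, hv, hlt⟩ := h
  obtain ⟨j, hj⟩ := Function.ne_iff.1 hv
  set w := Matrix.vecMul (fun i ↦ (v i : ℝ)) g.1 with hw
  have hvw : (v j : ℝ) = ∑ i, w i * g⁻¹ i j := by
    have hg : g.1 * (g⁻¹).1 = 1 := by
      rw [← Matrix.SpecialLinearGroup.coe_mul, mul_inv_cancel, Matrix.SpecialLinearGroup.coe_one]
    change _ = Matrix.vecMul w (g⁻¹).1 j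
    rw [hw, Matrix.vecMul_vecMul, hg, Matrix.vecMul_one]
  calc (1 : ℝ) ≤ |(v j : ℝ)| := mod_cast Int.one_le_abs hj
    _ ≤ ∑ i, |w i * g⁻¹ i j| := hvw ▸ Finset.abs_sum_le_sum_abs _ _
    _ ≤ ∑ _i : n, ε * C := Finset.sum_le_sum fun i _ ↦ by
        rw [abs_mul]
        exact mul_le_mul ((norm_le_pi_norm w i).trans hlt.le) (hC i j) (abs_nonneg _)
          ((norm_nonneg w).trans hlt.le)
    _ = Fintype.card n * (ε * C) := by simp

end ShortVectors

/-- The cosets `Γ g` whose lattice `ℤ² g` has a nonzero vector of sup norm less than `ε`. -/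
def shortVectorSet (ε : ℝ) : Set ModularSpace :=
  {p | ∃ g, modularCoset g = p ∧ HasShortVector ε g}

theorem modularCoset_mem_shortVectorSet {ε : ℝ} {g : SL(2, ℝ)} :
    modularCoset g ∈ shortVectorSet ε ↔ HasShortVector ε g := by
  refine ⟨?_, fun h ↦ ⟨g, rfl, h⟩⟩
  rintro ⟨h, hg, hs⟩
  obtain ⟨γ, rfl⟩ := modularCoset_eq_iff.1 hg.symm
  exact hs.of_intCast_mul

theorem shortVectorSet_mono : Monotone shortVectorSet :=
  fun _ _ h _ ⟨g, hg, hs⟩ ↦ ⟨g, hg, hs.mono h⟩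

theorem im_smul_I (g : SL(2, ℝ)) :
    (g • UpperHalfPlane.I).im = 1 / (g 1 0 ^ 2 + g 1 1 ^ 2) := by
  have h := UpperHalfPlane.im_smul_eq_div_normSq (g : GL (Fin 2) ℝ) UpperHalfPlane.I
  rw [UpperHalfPlane.denom, Complex.normSq_apply] at h
  simpa [sq, add_comm] using! h

theorem sq_le_of_not_hasShortVector {ε : ℝ} (hε : 0 < ε) {g : SL(2, ℝ)}
    (h : ¬ HasShortVector ε g) : ε ^ 2 ≤ g 1 0 ^ 2 + g 1 1 ^ 2 := by
  contrapose! h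
  refine ⟨![0, 1], by simp, ?_⟩
  refine (pi_norm_lt_iff hε).2 fun j ↦ abs_lt_of_sq_lt_sq ?_ hε.le
  fin_cases j <;> simp [Matrix.vecMul, dotProduct] <;>
    nlinarith [sq_nonneg (g 1 0), sq_nonneg (g 1 1)]

theorem isCuspNhd_shortVectorSet {ε : ℝ} (hε : 0 < ε) : IsCuspNhd (shortVectorSet ε) := by
  have hK : IsCompact ((fun g : SL(2, ℝ) ↦ g • UpperHalfPlane.I) ⁻¹'
      ModularGroup.truncatedFundamentalDomain (1 / ε ^ 2)) :=
    UpperHalfPlane.isProperMap_smul_I.isCompact_preimage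
      (ModularGroup.isCompact_truncatedFundamentalDomain _)
  refine mem_cocompact'.2 ⟨_, hK.image isOpenQuotientMap_modularCoset.continuous, fun p hp ↦ ?_⟩
  obtain ⟨g, rfl⟩ := isOpenQuotientMap_modularCoset.surjective p
  obtain ⟨γ, hγ⟩ := ModularGroup.exists_smul_mem_fd (g • UpperHalfPlane.I)
  have hγg : ¬ HasShortVector ε ((γ : SL(2, ℝ)) * g) := by
    rw [hasShortVector_intCast_mul_iff]
    exact fun h ↦ hp (modularCoset_mem_shortVectorSet.2 h)
  refine ⟨(γ : SL(2, ℝ)) * g, ⟨?_, ?_⟩, (modularCoset_eq_iff.2 ⟨γ, rfl⟩).symm⟩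
  · change ((γ : SL(2, ℝ)) * g) • UpperHalfPlane.I ∈ _
    rwa [mul_smul]
  · rw [im_smul_I]
    exact one_div_le_one_div_of_le (by positivity) (sq_le_of_not_hasShortVector hε hγg)

theorem exists_forall_abs_inv_apply_lt {K : Set ModularSpace} (hK : IsCompact K) :
    ∃ C : ℕ, ∀ p ∈ K, ∃ g : SL(2, ℝ), modularCoset g = p ∧ ∀ i j, |g⁻¹ i j| < C := by
  let V : ℕ → Set SL(2, ℝ) := fun C ↦ {g | ∀ i j, |g⁻¹ i j| < C}
  have hV (C : ℕ) : IsOpen (V C) := by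
    simp only [V, Set.ofPred_forall]
    refine isOpen_iInter_of_finite fun i ↦ isOpen_iInter_of_finite fun j ↦ ?_
    have : Continuous fun g : SL(2, ℝ) ↦ |g⁻¹ i j| := by fun_prop
    exact isOpen_lt this continuous_const
  have hcover : K ⊆ ⋃ C, modularCoset '' V C := fun p _ ↦ by
    obtain ⟨g, rfl⟩ := isOpenQuotientMap_modularCoset.surjective p
    obtain ⟨C, hC⟩ := exists_nat_gt (∑ i, ∑ j, |g⁻¹ i j|)
    refine Set.mem_iUnion.2 ⟨C, g, fun i j ↦ lt_of_le_of_lt ?_ hC, rfl⟩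
    exact (Finset.single_le_sum (f := fun j ↦ |g⁻¹ i j|) (fun _ _ ↦ abs_nonneg _)
      (Finset.mem_univ j)).trans (Finset.single_le_sum (f := fun i ↦ ∑ j, |g⁻¹ i j|)
        (fun _ _ ↦ Finset.sum_nonneg fun _ _ ↦ abs_nonneg _) (Finset.mem_univ i))
  have hdir : Directed (· ⊆ ·) fun C ↦ modularCoset '' V C :=
    Monotone.directed_le fun C D h ↦ Set.image_mono fun g hg i j ↦ (hg i j).trans_le (mod_cast h)
  obtain ⟨C, hC⟩ := hK.elim_directed_cover _
    (fun C ↦ isOpenQuotientMap_modularCoset.isOpenMap _ (hV C)) hcover hdir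
  exact ⟨C, fun p hp ↦ let ⟨g, hg, h⟩ := hC hp; ⟨g, h, hg⟩⟩

theorem hasBasis_cocompact_modularSpace :
    (cocompact ModularSpace).HasBasis (0 < ·) shortVectorSet := by
  refine ⟨fun U ↦ ⟨fun hU ↦ ?_, fun ⟨ε, hε, h⟩ ↦ mem_of_superset (isCuspNhd_shortVectorSet hε) h⟩⟩
  obtain ⟨K, hK, hKU⟩ := mem_cocompact.1 hU
  obtain ⟨C, hC⟩ := exists_forall_abs_inv_apply_lt hK
  refine ⟨1 / (2 * (C + 1)), by positivity, fun p hp ↦ hKU fun hpK ↦ ?_⟩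
  obtain ⟨g, rfl, hg⟩ := hC p hpK
  have := (modularCoset_mem_shortVectorSet.1 hp).one_le_mul fun i j ↦ (hg i j).le
  rw [Fintype.card_fin, Nat.cast_ofNat, ← mul_assoc, one_div, mul_inv,
    mul_inv_cancel_left₀ two_ne_zero, inv_mul_eq_div, le_div_iff₀ (by positivity)] at this
  linarith

/-! ### Occupation times -/

open Asymptotics Finset

/-- The (outer) Lebesgue measure of the times in `[0, T]` that belong to `S`. -/
noncomputable def occupationTime (S : Set ℝ) (T : ℝ) : ℝ := volume.real (Set.Icc 0 T ∩ S)

namespace occupationTime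

variable {S : Set ℝ} {a b : ℝ}

theorem sub_eq (ha : 0 ≤ a) (hab : a ≤ b) :
    occupationTime S b - occupationTime S a = volume.real (Set.Ioc a b ∩ S) := by
  have hfin : volume (Set.Icc 0 b ∩ S) ≠ ⊤ :=
    measure_ne_top_of_subset Set.inter_subset_left measure_Icc_lt_top.ne
  have hle : Set.Icc 0 b ∩ S ∩ Set.Iic a = Set.Icc 0 a ∩ S := by
    ext t; grind
  have hgt : (Set.Icc 0 b ∩ S) \ Set.Iic a = Set.Ioc a b ∩ S := by
    ext t; grind
  rw [occupationTime, occupationTime, ← hle, ← hgt,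
    ← measureReal_inter_add_sdiff measurableSet_Iic hfin, add_sub_cancel_left]

theorem nonneg (S : Set ℝ) (T : ℝ) : 0 ≤ occupationTime S T := measureReal_nonneg

theorem apply_zero (S : Set ℝ) : occupationTime S 0 = 0 := by
  rw [occupationTime, Set.Icc_self, measureReal_def,
    measure_mono_null Set.inter_subset_left Real.volume_singleton, ENNReal.toReal_zero]

theorem monotoneOn (S : Set ℝ) : MonotoneOn (occupationTime S) (Set.Ici 0) :=
  fun _ ha _ _ hab ↦ sub_nonneg.1 (sub_eq ha hab ▸ measureReal_nonneg)

theorem monotoneOn_id_sub (S : Set ℝ) :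
    MonotoneOn (fun T ↦ T - occupationTime S T) (Set.Ici 0) := fun a ha b _ hab ↦ by
  have hle : volume.real (Set.Ioc a b ∩ S) ≤ b - a := by
    rw [← Real.volume_real_Ioc_of_le hab]
    exact measureReal_mono Set.inter_subset_left measure_Ioc_lt_top.ne
  change a - _ ≤ b - _
  linarith [sub_eq (S := S) ha hab]

theorem le_self {T : ℝ} (hT : 0 ≤ T) : occupationTime S T ≤ T := by
  have h := monotoneOn_id_sub S Set.self_mem_Ici hT hT
  simp only [apply_zero] at h
  linarith

theorem eq_sum {l : ℕ → ℝ} (hl : Monotone l) (h0 : l 0 = 0) (N : ℕ) :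
    occupationTime S (l N) = ∑ k ∈ range N, volume.real (Set.Ioc (l k) (l (k + 1)) ∩ S) := by
  rw [← sub_zero (occupationTime S (l N)), ← apply_zero S, ← h0,
    ← sum_range_sub fun k ↦ occupationTime S (l k)]
  exact sum_congr rfl fun k _ ↦ sub_eq (h0 ▸ hl k.zero_le) (hl k.le_succ)

theorem mono {S' : Set ℝ} (h : S ⊆ S') (T : ℝ) : occupationTime S T ≤ occupationTime S' T :=
  measureReal_mono (Set.inter_subset_inter_right _ h)
    (measure_ne_top_of_subset Set.inter_subset_left measure_Icc_lt_top.ne)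

theorem tendsto_div_zero_iff :
    Tendsto (fun T ↦ occupationTime S T / T) atTop (𝓝 0) ↔ occupationTime S =o[atTop] id :=
  (isLittleO_iff_tendsto' ((eventually_ne_atTop 0).mono fun _ h h' ↦ (h h').elim)).symm

theorem tendsto_div_one_iff :
    Tendsto (fun T ↦ occupationTime S T / T) atTop (𝓝 1) ↔
      (fun T ↦ T - occupationTime S T) =o[atTop] id := by
  refine (isEquivalent_iff_tendsto_one (eventually_ne_atTop 0)).symm.trans ?_
  exact isLittleO_neg_left.symm.trans (by simp [Function.id_def])

theorem isLittleO_id_sub_of_eventually_mem (h : ∀ᶠ t in atTop, t ∈ S) :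
    (fun T ↦ T - occupationTime S T) =o[atTop] id := by
  obtain ⟨a, ha, hS⟩ : ∃ a : ℝ, 0 ≤ a ∧ ∀ t, a ≤ t → t ∈ S := by
    obtain ⟨a, ha⟩ := eventually_atTop.1 h
    exact ⟨max a 0, le_max_right _ _, fun t ht ↦ ha t (le_of_max_le_left ht)⟩
  refine (isLittleO_const_id_atTop (a - occupationTime S a)).congr' ?_ .rfl
  filter_upwards [eventually_ge_atTop a] with T hT
  have h := sub_eq (S := S) ha hT
  rw [Set.inter_eq_left.2 fun t ht ↦ hS t ht.1.le, Real.volume_real_Ioc_of_le hT] at h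
  linarith

end occupationTime

theorem isLittleO_id_of_isLittleO_comp_succ {u : ℝ → ℝ} {l : ℕ → ℝ}
    (hu : MonotoneOn u (Set.Ici 0)) (hu0 : ∀ t, 0 ≤ t → 0 ≤ u t) (hl : Tendsto l atTop atTop)
    (h : (fun N ↦ u (l (N + 1))) =o[atTop] l) : u =o[atTop] id := by
  refine isLittleO_iff.2 fun c hc ↦ ?_
  obtain ⟨M, hM⟩ := eventually_atTop.1 ((isLittleO_iff.1 h hc).and (hl.eventually_ge_atTop 0))
  filter_upwards [eventually_ge_atTop (l M)] with T hT
  obtain ⟨N, hMN, hNT, hTN⟩ : ∃ N, M ≤ N ∧ l N ≤ T ∧ T < l (N + 1) := by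
    by_contra! hstep
    have hle (k : ℕ) : l (M + k) ≤ T := by
      induction k with
      | zero => exact hT
      | succ k ih => exact hstep _ (M.le_add_right k) ih
    obtain ⟨k, hk⟩ := eventually_atTop.1 (hl.eventually_gt_atTop T)
    exact (hk (M + k) (k.le_add_left M)).not_ge (hle k)
  obtain ⟨hbound, hN⟩ := hM N hMN
  have hT0 : 0 ≤ T := hN.trans hNT
  rw [Real.norm_of_nonneg hN] at hbound
  calc ‖u T‖ = u T := Real.norm_of_nonneg (hu0 T hT0)
    _ ≤ u (l (N + 1)) := hu hT0 (hT0.trans hTN.le) hTN.le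
    _ ≤ c * l N := (le_abs_self _).trans hbound
    _ ≤ c * ‖id T‖ := by
      rw [id, Real.norm_of_nonneg hT0]
      gcongr

/-- The total length by which the first `N` gaps of the sequence `l` exceed `C`. -/
noncomputable def gapExcess (l : ℕ → ℝ) (C : ℝ) (N : ℕ) : ℝ :=
  ∑ k ∈ range N, max (l (k + 1) - l k - C) 0

namespace gapExcess

variable {l : ℕ → ℝ} {C D : ℝ} {N : ℕ}

theorem nonneg (l : ℕ → ℝ) (C : ℝ) (N : ℕ) : 0 ≤ gapExcess l C N :=
  sum_nonneg fun _ _ ↦ le_max_right _ _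

theorem anti (h : C ≤ D) : gapExcess l D N ≤ gapExcess l C N :=
  sum_le_sum fun _ _ ↦ max_le_max (by linarith) le_rfl

theorem le_sub (hl : Monotone l) (hC : 0 ≤ C) (N : ℕ) : gapExcess l C N ≤ l N - l 0 := by
  rw [gapExcess, ← sum_range_sub]
  exact sum_le_sum fun k _ ↦ max_le (sub_le_self _ hC) (sub_nonneg.2 (hl k.le_succ))

theorem sub_eq_sum_min (l : ℕ → ℝ) (C : ℝ) (N : ℕ) :
    l N - l 0 - gapExcess l C N = ∑ k ∈ range N, min (l (k + 1) - l k) C := by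
  rw [gapExcess, ← sum_range_sub, ← sum_sub_distrib]
  refine sum_congr rfl fun k _ ↦ ?_
  rw [max_def, min_def]
  split_ifs <;> linarith

theorem sub_le_mul (l : ℕ → ℝ) (C : ℝ) (N : ℕ) : l N - l 0 - gapExcess l C N ≤ N * C := by
  rw [sub_eq_sum_min]
  simpa using sum_le_card_nsmul (range N) _ C fun k _ ↦ min_le_right (l (k + 1) - l k) C

theorem mul_le_sub (hl : Monotone l) {δ : ℝ} (hδ0 : 0 ≤ δ) (hδ : ∀ k, δ ≤ l (k + 2) - l k)
    (hδC : δ ≤ C) (N : ℕ) : (N - 1) * (δ / 2) ≤ l N - l 0 - gapExcess l C N := by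
  rw [sub_eq_sum_min]
  have hmin (k : ℕ) : 0 ≤ min (l (k + 1) - l k) C :=
    le_min (sub_nonneg.2 (hl k.le_succ)) (hδ0.trans hδC)
  induction N using Nat.twoStepInduction with
  | zero =>
    rw [range_zero, sum_empty]
    push_cast
    linarith
  | one => simpa using hmin 0
  | more N ih _ =>
    have htwo : δ ≤ min (l (N + 1) - l N) C + min (l (N + 2) - l (N + 1)) C := by
      have := hδ N
      have := hl N.le_succ
      have := hl (N + 1).le_succ
      grind
    rw [sum_range_succ, sum_range_succ]
    push_cast
    linarith

end gapExcess

/-! ### Convergents -/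

section ContinuedFraction

theorem exists_int_contsAux_of {K : Type*} [Field K] [LinearOrder K] [IsStrictOrderedRing K]
    [FloorRing K] (x : K) (n : ℕ) :
    ∃ p q : ℤ, (GenContFract.of x).contsAux n = ⟨p, q⟩ := by
  induction n using Nat.twoStepInduction with
  | zero => exact ⟨1, 0, by simp [GenContFract.contsAux]⟩
  | one => exact ⟨⌊x⌋, 1, by simp [GenContFract.contsAux]⟩
  | more n ih ih' =>
    obtain ⟨p, q, h⟩ := ih
    obtain ⟨p', q', h'⟩ := ih'
    cases hs : (GenContFract.of x).s.get? n with
    | none => exact ⟨p', q', by rw [GenContFract.contsAux, hs]; exact h'⟩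
    | some gp =>
      obtain ⟨ha, z, hz⟩ := GenContFract.of_partNum_eq_one_and_exists_int_partDen_eq hs
      refine ⟨z * p' + p, z * q' + q, ?_⟩
      rw [GenContFract.contsAux_recurrence hs h h', ha, hz]
      simp

variable {x : ℝ}

theorem not_terminatedAt_of_irrational (hx : Irrational x) (k : ℕ) :
    ¬ (GenContFract.of x).TerminatedAt k := fun hk ↦
  let ⟨r, hr⟩ := (GenContFract.terminates_iff_rat x).1 ⟨k, hk⟩
  hx ⟨r, hr.symm⟩

theorem get?_s_of_irrational (hx : Irrational x) (k : ℕ) :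
    (GenContFract.of x).s.get? k = some ⟨1, partialQuotient x (k + 1)⟩ := by
  obtain ⟨gp, hgp⟩ := Option.ne_none_iff_exists'.1 (not_terminatedAt_of_irrational hx k)
  have hb : partialQuotient x (k + 1) = gp.b := by
    simp [partialQuotient, GenContFract.partDen_eq_s_b hgp]
  rw [hgp, hb, ← (GenContFract.of_partNum_eq_one_and_exists_int_partDen_eq hgp).1]

theorem get?_partDens_of_irrational (hx : Irrational x) (k : ℕ) :
    (GenContFract.of x).partDens.get? k = some (partialQuotient x (k + 1)) :=
  GenContFract.partDen_eq_s_b (get?_s_of_irrational hx k)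

theorem one_le_partialQuotient_succ (hx : Irrational x) (k : ℕ) : 1 ≤ partialQuotient x (k + 1) :=
  GenContFract.of_one_le_get?_partDen (get?_partDens_of_irrational hx k)

theorem one_le_dens_of (x : ℝ) (k : ℕ) : 1 ≤ (GenContFract.of x).dens k :=
  GenContFract.zeroth_den_eq_one.ge.trans
    (monotone_nat_of_le_succ (f := (GenContFract.of x).dens) (fun _ ↦ GenContFract.of_den_mono)
      k.zero_le)

theorem dens_of_add_two (hx : Irrational x) (k : ℕ) :
    (GenContFract.of x).dens (k + 2) =
      partialQuotient x (k + 2) * (GenContFract.of x).dens (k + 1) +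
        (GenContFract.of x).dens k := by
  simpa using GenContFract.dens_recurrence (get?_s_of_irrational hx (k + 1)) rfl rfl

theorem two_mul_dens_of_le (hx : Irrational x) (k : ℕ) :
    2 * (GenContFract.of x).dens k ≤ (GenContFract.of x).dens (k + 2) := by
  have hmono : (GenContFract.of x).dens k ≤ (GenContFract.of x).dens (k + 1) :=
    GenContFract.of_den_mono
  rw [dens_of_add_two hx]
  nlinarith [one_le_partialQuotient_succ hx (k + 1), one_le_dens_of x (k + 1)]

theorem dens_of_succ_le (hx : Irrational x) (k : ℕ) :
    (GenContFract.of x).dens (k + 1) ≤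
      2 * (partialQuotient x (k + 1) * (GenContFract.of x).dens k) := by
  have ha := one_le_partialQuotient_succ hx k
  cases k with
  | zero =>
    rw [GenContFract.first_den_eq (get?_s_of_irrational hx 0), GenContFract.zeroth_den_eq_one]
    linarith
  | succ k =>
    have hmono : (GenContFract.of x).dens k ≤ (GenContFract.of x).dens (k + 1) :=
      GenContFract.of_den_mono
    rw [dens_of_add_two hx]
    nlinarith [one_le_dens_of x (k + 1)]

theorem determinant_of (hx : Irrational x) (k : ℕ) :
    (GenContFract.of x).nums k * (GenContFract.of x).dens (k + 1) -
      (GenContFract.of x).dens k * (GenContFract.of x).nums (k + 1) = (-1) ^ (k + 1) :=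
  SimpContFract.determinant (s := SimpContFract.of x) (not_terminatedAt_of_irrational hx k)

theorem exists_isCoprime_nums_dens (hx : Irrational x) (k : ℕ) :
    ∃ p q : ℤ, IsCoprime p q ∧ (GenContFract.of x).nums k = p ∧ (GenContFract.of x).dens k = q := by
  obtain ⟨p, q, h⟩ := exists_int_contsAux_of x (k + 1)
  obtain ⟨p', q', h'⟩ := exists_int_contsAux_of x (k + 2)
  have hp : (GenContFract.of x).nums k = p := congrArg GenContFract.Pair.a h
  have hq : (GenContFract.of x).dens k = q := congrArg GenContFract.Pair.b h
  have hp' : (GenContFract.of x).nums (k + 1) = p' := congrArg GenContFract.Pair.a h'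
  have hq' : (GenContFract.of x).dens (k + 1) = q' := congrArg GenContFract.Pair.b h'
  have hdet := determinant_of hx k
  rw [hp, hq, hp', hq'] at hdet
  have hdet : p * q' - q * p' = (-1) ^ (k + 1) := mod_cast hdet
  have hsq : ((-1) ^ (k + 1) : ℤ) * (-1) ^ (k + 1) = 1 := by rw [← mul_pow]; simp
  exact ⟨p, q, ⟨(-1) ^ (k + 1) * q', -((-1) ^ (k + 1) * p'), by
    linear_combination (-1) ^ (k + 1) * hdet + hsq⟩, hp, hq⟩

/-- `‖q_k x‖ = |q_k x - p_k|`, where `p_k / q_k` is the `k`-th convergent of `x`. -/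
noncomputable def convError (x : ℝ) (k : ℕ) : ℝ :=
  |(GenContFract.of x).dens k * x - (GenContFract.of x).nums k|

theorem convError_mul_dens_le (hx : Irrational x) (k : ℕ) :
    convError x k * (GenContFract.of x).dens (k + 1) ≤ 1 := by
  have h := GenContFract.abs_sub_convs_le (not_terminatedAt_of_irrational hx k)
  have h0 : 0 < (GenContFract.of x).dens k := one_pos.trans_le (one_le_dens_of x k)
  have h1 : 0 < (GenContFract.of x).dens (k + 1) := one_pos.trans_le (one_le_dens_of x (k + 1))
  have hfactor : (GenContFract.of x).dens k * x - (GenContFract.of x).nums k =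
      (GenContFract.of x).dens k * (x - (GenContFract.of x).convs k) := by
    rw [GenContFract.conv_eq_num_div_den, mul_sub, mul_div_cancel₀ _ h0.ne']
  rw [le_div_iff₀ (mul_pos h0 h1)] at h
  rw [convError, hfactor, abs_mul, abs_of_pos h0]
  linarith

/-- The determinant identity gives `q_k ‖q_{k+1} x‖ + q_{k+1} ‖q_k x‖ ≥ 1`, and the first term is
at most `q_k / q_{k+2} ≤ 1 / 2`. -/
theorem one_le_two_mul_convError_mul_dens (hx : Irrational x) (k : ℕ) :
    1 ≤ 2 * (convError x k * (GenContFract.of x).dens (k + 1)) := by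
  have herr := convError_mul_dens_le hx (k + 1)
  have htwo := two_mul_dens_of_le hx k
  have h0 := one_le_dens_of x k
  have h1 := one_le_dens_of x (k + 1)
  have hdet := congrArg abs (determinant_of hx k)
  rw [convError] at *
  set q := (GenContFract.of x).dens
  set p := (GenContFract.of x).nums
  have hsum : 1 ≤ q k * |q (k + 1) * x - p (k + 1)| + q (k + 1) * |q k * x - p k| := by
    calc 1 = |q k * (q (k + 1) * x - p (k + 1)) - q (k + 1) * (q k * x - p k)| := by
          rw [abs_pow, abs_neg, abs_one, one_pow] at hdet
          rw [← hdet]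
          ring_nf
      _ ≤ _ := (abs_sub _ _).trans_eq (by
          rw [abs_mul, abs_mul, abs_of_pos (by linarith : 0 < q k),
            abs_of_pos (by linarith : 0 < q (k + 1))])
  nlinarith [abs_nonneg (q (k + 1) * x - p (k + 1))]

theorem convError_pos (hx : Irrational x) (k : ℕ) : 0 < convError x k := by
  have h1 := one_le_dens_of x (k + 1)
  by_contra! h
  nlinarith [one_le_two_mul_convError_mul_dens hx k]

/-- `2 log q_k`, the time at which the vector of the lattice of `Γ_x a_t` coming from the `k`-th
convergent `p_k / q_k` of `x` has first coordinate `1`. -/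
noncomputable def convTime (x : ℝ) (k : ℕ) : ℝ := 2 * Real.log ((GenContFract.of x).dens k)

theorem convTime_zero (x : ℝ) : convTime x 0 = 0 := by
  rw [convTime, GenContFract.zeroth_den_eq_one, Real.log_one, mul_zero]

theorem convTime_mono (x : ℝ) : Monotone (convTime x) :=
  monotone_nat_of_le_succ fun k ↦ mul_le_mul_of_nonneg_left
    (Real.log_le_log (one_pos.trans_le (one_le_dens_of x k)) GenContFract.of_den_mono) zero_le_two

theorem two_mul_log_le_convTime_sub (hx : Irrational x) (k : ℕ) :
    2 * Real.log (partialQuotient x (k + 1)) ≤ convTime x (k + 1) - convTime x k := by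
  have ha := one_pos.trans_le (one_le_partialQuotient_succ hx k)
  have hq := one_pos.trans_le (one_le_dens_of x k)
  have h := Real.log_le_log (mul_pos ha hq)
    (GenContFract.le_of_succ_get?_den (get?_partDens_of_irrational hx k))
  rw [Real.log_mul ha.ne' hq.ne'] at h
  rw [convTime, convTime]
  linarith

theorem convTime_sub_le (hx : Irrational x) (k : ℕ) :
    convTime x (k + 1) - convTime x k ≤
      2 * Real.log (partialQuotient x (k + 1)) + 2 * Real.log 2 := by
  have ha := one_pos.trans_le (one_le_partialQuotient_succ hx k)
  have hq := one_pos.trans_le (one_le_dens_of x k)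
  have h := Real.log_le_log (one_pos.trans_le (one_le_dens_of x (k + 1))) (dens_of_succ_le hx k)
  rw [Real.log_mul two_ne_zero (mul_pos ha hq).ne', Real.log_mul ha.ne' hq.ne'] at h
  rw [convTime, convTime]
  linarith

theorem two_mul_log_two_le_convTime_sub (hx : Irrational x) (k : ℕ) :
    2 * Real.log 2 ≤ convTime x (k + 2) - convTime x k := by
  have hq := one_pos.trans_le (one_le_dens_of x k)
  have h := Real.log_le_log (by positivity) (two_mul_dens_of_le hx k)
  rw [Real.log_mul two_ne_zero hq.ne'] at h
  rw [convTime, convTime]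
  linarith

theorem gapExcess_convTime_le (x : ℝ) {C : ℝ} (hC : 0 ≤ C) (N : ℕ) :
    gapExcess (convTime x) C N ≤ convTime x N := by
  simpa [convTime_zero] using gapExcess.le_sub (convTime_mono x) hC N

theorem convTime_sub_gapExcess_le (x : ℝ) (C : ℝ) (N : ℕ) :
    convTime x N - gapExcess (convTime x) C N ≤ N * C := by
  simpa [convTime_zero] using gapExcess.sub_le_mul (convTime x) C N

theorem mul_log_two_le_convTime_sub_gapExcess (hx : Irrational x) {C : ℝ}
    (hC : 2 * Real.log 2 ≤ C) (N : ℕ) :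
    (N - 1) * Real.log 2 ≤ convTime x N - gapExcess (convTime x) C N := by
  simpa [convTime_zero] using gapExcess.mul_le_sub (convTime_mono x)
    (mul_nonneg zero_le_two (Real.log_nonneg one_le_two)) (two_mul_log_two_le_convTime_sub hx) hC N

theorem mul_log_two_le_convTime (hx : Irrational x) (N : ℕ) :
    (N - 1) * Real.log 2 ≤ convTime x N :=
  (mul_log_two_le_convTime_sub_gapExcess hx le_rfl N).trans
    (sub_le_self _ (gapExcess.nonneg _ _ _))

theorem tendsto_convTime (hx : Irrational x) : Tendsto (convTime x) atTop atTop :=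
  tendsto_atTop_mono (mul_log_two_le_convTime hx) <|
    (tendsto_atTop_add_const_right _ (-1) tendsto_natCast_atTop_atTop).atTop_mul_const
      (Real.log_pos one_lt_two)

theorem two_mul_log_convError_mem (hx : Irrational x) (k : ℕ) :
    -2 * Real.log (convError x k) ∈
      Set.Icc (convTime x (k + 1)) (convTime x (k + 1) + 2 * Real.log 2) := by
  have hq := one_pos.trans_le (one_le_dens_of x (k + 1))
  have he := convError_pos hx k
  have hle := Real.log_nonpos (mul_pos he hq).le (convError_mul_dens_le hx k)
  have hge := Real.log_nonneg (one_le_two_mul_convError_mul_dens hx k)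
  rw [Real.log_mul two_ne_zero (mul_pos he hq).ne'] at hge
  rw [Real.log_mul he.ne' hq.ne'] at hle hge
  rw [convTime]
  constructor <;> linarith

end ContinuedFraction

/-! ### Visits to the neighbourhoods of the cusp -/

theorem cuspOrbit_mem_shortVectorSet_iff {x t ε : ℝ} (hε : 0 < ε) :
    cuspOrbit x t ∈ shortVectorSet ε ↔ ∃ m n : ℤ, (m ≠ 0 ∨ n ≠ 0) ∧
      |(m : ℝ)| < ε * Real.exp (t / 2) ∧ |m * x + n| * Real.exp (t / 2) < ε := by
  have horbit : cuspOrbit x t = modularCoset (unipotent x * diagFlow t) := rfl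
  have hv (v : Fin 2 → ℤ) : ‖Matrix.vecMul (fun i ↦ (v i : ℝ)) (unipotent x * diagFlow t).1‖ < ε ↔
      |(v 0 : ℝ)| < ε * Real.exp (t / 2) ∧ |v 0 * x + v 1| * Real.exp (t / 2) < ε := by
    rw [pi_norm_lt_iff hε, Matrix.SpecialLinearGroup.coe_mul, ← Matrix.vecMul_vecMul,
      Fin.forall_fin_two]
    refine and_congr ?_ ?_
    · rw [← div_lt_iff₀ (Real.exp_pos _), div_eq_mul_inv, ← Real.exp_neg, ← neg_div]
      simp [unipotent, diagFlow, Matrix.vecMul, dotProduct]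
    · simp [unipotent, diagFlow, Matrix.vecMul, dotProduct]
  rw [horbit, modularCoset_mem_shortVectorSet, HasShortVector]
  simp only [hv]
  constructor
  · rintro ⟨v, hv0, hlt⟩
    refine ⟨v 0, v 1, ?_, hlt⟩
    by_contra! h
    exact hv0 (funext (Fin.forall_fin_two.2 h))
  · rintro ⟨m, n, hmn, hlt⟩
    refine ⟨![m, n], fun h ↦ ?_, hlt⟩
    exact hmn.elim (fun hm ↦ hm (congrFun h 0)) fun hn ↦ hn (congrFun h 1)

/-- The integer `m p + n q = q (m x + n) - m (q x - p)` vanishes. -/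
theorem eq_mul_of_abs_mul_add_lt_one {p q : ℤ} (hpq : IsCoprime p q) (hq : 0 < q) {x : ℝ} {m n : ℤ}
    (h : |(m : ℝ)| * |q * x - p| + q * |m * x + n| < 1) : ∃ c : ℤ, m = c * q ∧ n = -(c * p) := by
  have hzero : m * p + n * q = 0 := by
    rw [← Int.abs_lt_one_iff, ← @Int.cast_lt ℝ]
    have hq' : (0 : ℝ) < q := mod_cast hq
    calc ((|m * p + n * q| : ℤ) : ℝ) = |q * (m * x + n) - m * (q * x - p)| := by
          push_cast
          ring_nf
      _ ≤ |q * (m * x + n)| + |m * (q * x - p)| := abs_sub _ _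
      _ = |(m : ℝ)| * |q * x - p| + q * |m * x + n| := by
          rw [abs_mul, abs_mul, abs_of_pos hq', add_comm]
      _ < (1 : ℤ) := mod_cast h
  obtain ⟨c, rfl⟩ : q ∣ m := hpq.symm.dvd_of_dvd_mul_right ⟨-n, by linear_combination hzero⟩
  refine ⟨c, mul_comm _ _, mul_right_cancel₀ hq.ne' ?_⟩
  linear_combination hzero

/-- As `|m| |q x - p| + q |m x + n| < 2 ε` for a short vector `(m, n)`, it is a multiple of
`(q, -p)`. -/
theorem exists_short_iff_of_isCoprime {p q : ℤ} (hpq : IsCoprime p q) (hq : 0 < q) {x s ε : ℝ}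
    (hε : ε ≤ 1 / 2) (hqs : q ≤ s) (herr : |q * x - p| * s ≤ 1) :
    (∃ m n : ℤ, (m ≠ 0 ∨ n ≠ 0) ∧ |(m : ℝ)| < ε * s ∧ |m * x + n| * s < ε) ↔
      q < ε * s ∧ |q * x - p| * s < ε := by
  have hq' : (0 : ℝ) < q := mod_cast hq
  have hs : 0 < s := hq'.trans_le hqs
  constructor
  · rintro ⟨m, n, hmn, hm, hn⟩
    have hε0 : 0 < ε := (mul_nonneg (abs_nonneg _) hs.le).trans_lt hn
    obtain ⟨c, rfl, rfl⟩ : ∃ c : ℤ, m = c * q ∧ n = -(c * p) := by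
      refine eq_mul_of_abs_mul_add_lt_one (x := x) hpq hq ?_
      have hfst : |(m : ℝ)| * |q * x - p| ≤ ε := calc
        |(m : ℝ)| * |q * x - p| ≤ ε * s * |q * x - p| := by gcongr
        _ ≤ ε := by nlinarith
      have hsnd : q * |m * x + n| < ε := by
        rw [mul_comm]
        exact (mul_le_mul_of_nonneg_left hqs (abs_nonneg _)).trans_lt hn
      linarith
    have hc : 1 ≤ |(c : ℝ)| := by
      refine mod_cast Int.one_le_abs fun hc ↦ ?_
      simp [hc] at hmn
    push_cast at hm hn
    rw [abs_mul, abs_of_pos hq'] at hm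
    rw [show (c : ℝ) * q * x + -(c * p) = c * (q * x - p) by ring, abs_mul, mul_assoc] at hn
    exact ⟨(le_mul_of_one_le_left hq'.le hc).trans_lt hm,
      (le_mul_of_one_le_left (by positivity) hc).trans_lt hn⟩
  · rintro ⟨hlt, hlt'⟩
    refine ⟨q, -p, .inl hq.ne', ?_, ?_⟩
    · rwa [abs_of_pos hq']
    · push_cast
      rwa [← sub_eq_add_neg]

section Visits

variable {x ε : ℝ}

theorem cuspOrbit_mem_shortVectorSet_iff_of_mem_Icc (hx : Irrational x) (hε0 : 0 < ε)
    (hε : ε ≤ 1 / 2) {k : ℕ} {t : ℝ} (ht : t ∈ Set.Icc (convTime x k) (convTime x (k + 1))) :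
    cuspOrbit x t ∈ shortVectorSet ε ↔
      convTime x k - 2 * Real.log ε < t ∧ t < 2 * Real.log ε - 2 * Real.log (convError x k) := by
  have hq0 := one_pos.trans_le (one_le_dens_of x k)
  have hq1 := one_pos.trans_le (one_le_dens_of x (k + 1))
  have herr0 := convError_pos hx k
  obtain ⟨p, q, hpq, hp, hq⟩ := exists_isCoprime_nums_dens hx k
  have hq_pos : 0 < q := Int.cast_pos.1 (hq0.trans_eq hq)
  have hle : q ≤ Real.exp (t / 2) := by
    rw [← hq, ← Real.log_le_iff_le_exp hq0]
    linarith [convTime.eq_def x k ▸ ht.1]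
  have herr : |q * x - p| * Real.exp (t / 2) ≤ 1 := by
    refine le_trans ?_ (convError_mul_dens_le hx k)
    rw [convError, hp, hq]
    gcongr
    rw [← Real.le_log_iff_exp_le hq1]
    linarith [convTime.eq_def x (k + 1) ▸ ht.2]
  rw [cuspOrbit_mem_shortVectorSet_iff hε0,
    exists_short_iff_of_isCoprime hpq hq_pos hε hle herr, ← hp, ← hq, ← convError,
    ← div_lt_iff₀' hε0, ← lt_div_iff₀' herr0, ← Real.log_lt_iff_lt_exp (div_pos hq0 hε0),
    ← Real.lt_log_iff_exp_lt (div_pos hε0 herr0), Real.log_div hq0.ne' hε0.ne',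
    Real.log_div hε0.ne' herr0.ne', convTime]
  constructor <;> rintro ⟨h1, h2⟩ <;> constructor <;> linarith

theorem gapExcess_le_occupationTime (hx : Irrational x) (hε0 : 0 < ε)
    (hε : ε ≤ 1 / 2) (N : ℕ) :
    gapExcess (convTime x) (-(4 * Real.log ε)) N ≤
      occupationTime {t | cuspOrbit x t ∈ shortVectorSet ε} (convTime x N) := by
  have hlog : Real.log ε ≤ 0 := Real.log_nonpos hε0.le (by linarith)
  rw [occupationTime.eq_sum (convTime_mono x) (convTime_zero x)]
  refine sum_le_sum fun k _ ↦ ?_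
  have herr := two_mul_log_convError_mem hx k
  calc max (convTime x (k + 1) - convTime x k - -(4 * Real.log ε)) 0
      = volume.real (Set.Ioo (convTime x k - 2 * Real.log ε)
          (convTime x (k + 1) + 2 * Real.log ε)) := by
        rw [Real.volume_real_Ioo]
        ring_nf
    _ ≤ _ := by
      refine measureReal_mono (fun t ht ↦ ?_)
        (measure_ne_top_of_subset Set.inter_subset_left measure_Ioc_lt_top.ne)
      have htk : t ∈ Set.Ioc (convTime x k) (convTime x (k + 1)) :=
        ⟨by linarith [ht.1], by linarith [ht.2]⟩
      refine ⟨htk, (cuspOrbit_mem_shortVectorSet_iff_of_mem_Icc hx hε0 hε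
        (Set.Ioc_subset_Icc_self htk)).2 ⟨ht.1, ?_⟩⟩
      linarith [ht.2, herr.1]

theorem occupationTime_le_gapExcess (hx : Irrational x) (hε0 : 0 < ε)
    (hε : ε ≤ 1 / 2) (N : ℕ) :
    occupationTime {t | cuspOrbit x t ∈ shortVectorSet ε} (convTime x N) ≤
      gapExcess (convTime x) (-(4 * Real.log ε) - 2 * Real.log 2) N := by
  rw [occupationTime.eq_sum (convTime_mono x) (convTime_zero x)]
  refine sum_le_sum fun k _ ↦ ?_
  have herr := two_mul_log_convError_mem hx k
  calc volume.real _
      ≤ volume.real (Set.Ioo (convTime x k - 2 * Real.log ε)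
          (convTime x (k + 1) + 2 * Real.log 2 + 2 * Real.log ε)) := by
        refine measureReal_mono (fun t ⟨htk, ht⟩ ↦ ?_) measure_Ioo_lt_top.ne
        have h := (cuspOrbit_mem_shortVectorSet_iff_of_mem_Icc hx hε0 hε
          (Set.Ioc_subset_Icc_self htk)).1 ht
        exact ⟨h.1, by linarith [h.2, herr.2]⟩
    _ = _ := by
        rw [Real.volume_real_Ioo]
        ring_nf

end Visits

/-! ### Frequencies -/

theorem hasBasis_cocompact_modularSpace_of_le :
    (cocompact ModularSpace).HasBasis (fun ε : ℝ ↦ 0 < ε ∧ ε ≤ 1 / 2) shortVectorSet :=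
  hasBasis_cocompact_modularSpace.restrict fun ε hε ↦
    ⟨min ε (1 / 2), lt_min hε one_half_pos, min_le_right _ _, shortVectorSet_mono (min_le_left _ _)⟩

theorem visitsCuspWithFrequencyZero_iff_isLittleO {x : ℝ} :
    VisitsCuspWithFrequencyZero x ↔ ∃ ε : ℝ, (0 < ε ∧ ε ≤ 1 / 2) ∧
      occupationTime {t | cuspOrbit x t ∈ shortVectorSet ε} =o[atTop] id := by
  simp only [← occupationTime.tendsto_div_zero_iff]
  refine hasBasis_cocompact_modularSpace_of_le.exists_iff fun U V hUV hV ↦ ?_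
  refine squeeze_zero' ?_ ?_ hV <;> filter_upwards [eventually_ge_atTop 0] with T hT
  · exact div_nonneg (occupationTime.nonneg _ _) hT
  · exact div_le_div_of_nonneg_right (occupationTime.mono (fun t ht ↦ hUV ht) T) hT

theorem visitsCuspWithFrequencyOne_iff_isLittleO {x : ℝ} :
    VisitsCuspWithFrequencyOne x ↔ ∀ ε : ℝ, 0 < ε ∧ ε ≤ 1 / 2 →
      (fun T ↦ T - occupationTime {t | cuspOrbit x t ∈ shortVectorSet ε} T) =o[atTop] id := by
  simp only [← occupationTime.tendsto_div_one_iff]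
  refine hasBasis_cocompact_modularSpace_of_le.forall_iff fun U V hUV hU ↦ ?_
  refine tendsto_of_tendsto_of_tendsto_of_le_of_le' hU tendsto_const_nhds ?_ ?_ <;>
    filter_upwards [eventually_ge_atTop 0] with T hT
  · exact div_le_div_of_nonneg_right (occupationTime.mono (fun t ht ↦ hUV ht) T) hT
  · exact div_le_one_of_le₀ (occupationTime.le_self hT) hT

theorem visitsCuspWithFrequencyOne_of_tendsto_cocompact {x : ℝ}
    (h : Tendsto (cuspOrbit x) atTop (cocompact ModularSpace)) : VisitsCuspWithFrequencyOne x :=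
  fun _ hU ↦ occupationTime.tendsto_div_one_iff.2
    (occupationTime.isLittleO_id_sub_of_eventually_mem (h.eventually_mem hU))

theorem tendsto_cuspOrbit_ratCast (r : ℚ) :
    Tendsto (cuspOrbit r) atTop (cocompact ModularSpace) := by
  refine hasBasis_cocompact_modularSpace.tendsto_right_iff.2 fun ε hε ↦ ?_
  have hexp : Tendsto (fun t : ℝ ↦ ε * Real.exp (t / 2)) atTop atTop :=
    (Real.tendsto_exp_atTop.comp (tendsto_id.atTop_div_const two_pos)).const_mul_atTop hε
  filter_upwards [hexp.eventually_gt_atTop (r.den : ℝ)] with t ht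
  refine (cuspOrbit_mem_shortVectorSet_iff hε).2
    ⟨r.den, -r.num, .inl (mod_cast r.den_ne_zero), by simpa using ht, ?_⟩
  have hzero : ((r.den : ℤ) : ℝ) * r + (-r.num : ℤ) = 0 := by
    have := Rat.den_mul_eq_num r
    have : (r.den : ℝ) * r = r.num := mod_cast this
    push_cast
    linarith
  rwa [hzero, abs_zero, zero_mul]

theorem VisitsCuspWithFrequencyOne.not_frequencyZero {x : ℝ} (h : VisitsCuspWithFrequencyOne x) :
    ¬ VisitsCuspWithFrequencyZero x := fun ⟨U, hU, h0⟩ ↦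
  zero_ne_one (tendsto_nhds_unique h0 (h U hU))

theorem sum_Icc_one_eq_sum_range {M : Type*} [AddCommMonoid M] (f : ℕ → M) (N : ℕ) :
    ∑ j ∈ Icc 1 N, f j = ∑ k ∈ range N, f (k + 1) := by
  rw [range_eq_Ico, sum_Ico_add' f 0 N 1]
  rfl

theorem isBigO_natCast_succ :
    (fun N : ℕ ↦ ((N + 1 : ℕ) : ℝ)) =O[atTop] fun N : ℕ ↦ (N : ℝ) := by
  refine .of_bound 2 ?_
  filter_upwards [eventually_ge_atTop 1] with N hN
  rw [Real.norm_natCast, Real.norm_natCast]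
  exact_mod_cast (by omega : N + 1 ≤ 2 * N)

theorem tendsto_div_natCast_atTop_iff {u : ℕ → ℝ} (hu : ∀ N, 0 ≤ u N) :
    Tendsto (fun N ↦ u N / N) atTop atTop ↔ (fun N : ℕ ↦ (N : ℝ)) =o[atTop] u := by
  refine ⟨IsLittleO.of_tendsto_div_atTop, fun h ↦ ?_⟩
  have hone : (fun _ ↦ (1 : ℝ)) =o[atTop] fun N ↦ u N / N :=
    (h.mul_isBigO (isBigO_refl (fun N : ℕ ↦ (N : ℝ)⁻¹) atTop)).congr'
      ((eventually_ne_atTop 0).mono fun N hN ↦ mul_inv_cancel₀ (Nat.cast_ne_zero.2 hN))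
      (.of_forall fun N ↦ (div_eq_mul_inv _ _).symm)
  exact ((isLittleO_one_left_iff ℝ).1 hone).congr fun N ↦
    Real.norm_of_nonneg (div_nonneg (hu N) N.cast_nonneg)

section Frequencies

variable {x : ℝ}

theorem isTheta_convTime_sub_gapExcess (hx : Irrational x) {C : ℝ} (hC : 2 * Real.log 2 ≤ C) :
    (fun N ↦ convTime x N - gapExcess (convTime x) C N) =Θ[atTop] fun N : ℕ ↦ (N : ℝ) := by
  have hlog := Real.log_pos one_lt_two
  have hnorm (N : ℕ) : ‖convTime x N - gapExcess (convTime x) C N‖ =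
      convTime x N - gapExcess (convTime x) C N :=
    Real.norm_of_nonneg (sub_nonneg.2 (gapExcess_convTime_le x (by linarith) N))
  refine ⟨.of_bound C (.of_forall fun N ↦ ?_), .of_bound (2 / Real.log 2) ?_⟩
  · rw [hnorm, Real.norm_natCast, mul_comm]
    exact convTime_sub_gapExcess_le x C N
  · filter_upwards [eventually_ge_atTop 2] with N hN
    have hN' : (2 : ℝ) ≤ N := mod_cast hN
    rw [hnorm, Real.norm_natCast, div_mul_eq_mul_div, le_div_iff₀ hlog]
    nlinarith [mul_log_two_le_convTime_sub_gapExcess hx hC N]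

theorem isBigO_natCast_convTime (hx : Irrational x) :
    (fun N : ℕ ↦ (N : ℝ)) =O[atTop] convTime x := by
  have hC : 0 ≤ 2 * Real.log 2 := mul_nonneg zero_le_two (Real.log_nonneg one_le_two)
  refine (isTheta_convTime_sub_gapExcess hx le_rfl).isBigO_symm.trans (isBigO_of_le _ fun N ↦ ?_)
  exact abs_le_abs_of_nonneg (sub_nonneg.2 (gapExcess_convTime_le x hC N))
    (sub_le_self _ (gapExcess.nonneg _ _ _))

theorem two_mul_log_two_le_neg_log {ε : ℝ} (hε0 : 0 < ε) (hε : ε ≤ 1 / 2) :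
    2 * Real.log 2 ≤ -(4 * Real.log ε) - 2 * Real.log 2 := by
  have h := Real.log_le_log hε0 hε
  rw [one_div, Real.log_inv] at h
  linarith

theorem visitsCuspWithFrequencyZero_iff_gapExcess (hx : Irrational x) :
    VisitsCuspWithFrequencyZero x ↔
      ∃ C, gapExcess (convTime x) C =o[atTop] fun N : ℕ ↦ (N : ℝ) := by
  rw [visitsCuspWithFrequencyZero_iff_isLittleO]
  constructor
  · rintro ⟨ε, ⟨hε0, hε⟩, h⟩
    have hC : 2 * Real.log 2 ≤ -(4 * Real.log ε) := by
      linarith [two_mul_log_two_le_neg_log hε0 hε, Real.log_nonneg one_le_two]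
    have hexcess : gapExcess (convTime x) (-(4 * Real.log ε)) =o[atTop] convTime x :=
      (isBigO_of_le _ fun N ↦ abs_le_abs_of_nonneg (gapExcess.nonneg _ _ N)
        (gapExcess_le_occupationTime hx hε0 hε N)).trans_isLittleO
          (h.comp_tendsto (tendsto_convTime hx))
    exact ⟨_, hexcess.trans_isBigO
      (hexcess.right_isBigO_sub.trans (isTheta_convTime_sub_gapExcess hx hC).isBigO)⟩
  · rintro ⟨C, hC⟩
    obtain ⟨ε, hε0, hε, hCε⟩ : ∃ ε : ℝ, 0 < ε ∧ ε ≤ 1 / 2 ∧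
        C ≤ -(4 * Real.log ε) - 2 * Real.log 2 := by
      refine ⟨Real.exp (-|C| / 4) / 2, by positivity, ?_, ?_⟩
      · have := Real.exp_le_one_iff.2 (show -|C| / 4 ≤ 0 by linarith [abs_nonneg C])
        linarith
      · rw [Real.log_div (Real.exp_pos _).ne' two_ne_zero, Real.log_exp]
        linarith [le_abs_self C, Real.log_nonneg one_le_two]
    refine ⟨ε, ⟨hε0, hε⟩, isLittleO_id_of_isLittleO_comp_succ (occupationTime.monotoneOn _)
      (fun t _ ↦ occupationTime.nonneg _ t) (tendsto_convTime hx) ?_⟩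
    have hexcess : (fun N ↦ gapExcess (convTime x) C (N + 1)) =o[atTop] convTime x :=
      (hC.comp_tendsto (tendsto_add_atTop_nat 1)).trans_isBigO
        (isBigO_natCast_succ.trans (isBigO_natCast_convTime hx))
    refine (isBigO_of_le _ fun N ↦ ?_).trans_isLittleO hexcess
    exact abs_le_abs_of_nonneg (occupationTime.nonneg _ _)
      ((occupationTime_le_gapExcess hx hε0 hε _).trans (gapExcess.anti hCε))

theorem visitsCuspWithFrequencyOne_iff_convTime (hx : Irrational x) :
    VisitsCuspWithFrequencyOne x ↔ (fun N : ℕ ↦ (N : ℝ)) =o[atTop] convTime x := by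
  rw [visitsCuspWithFrequencyOne_iff_isLittleO]
  constructor
  · intro h
    have hsub := (h (1 / 2) ⟨one_half_pos, le_rfl⟩).comp_tendsto (tendsto_convTime hx)
    have hC := two_mul_log_two_le_neg_log one_half_pos le_rfl
    refine (isTheta_convTime_sub_gapExcess hx hC).isBigO_symm.trans_isLittleO
      ((isBigO_of_le _ fun N ↦ ?_).trans_isLittleO hsub)
    have hC0 := (mul_nonneg zero_le_two (Real.log_nonneg one_le_two)).trans hC
    exact abs_le_abs_of_nonneg (sub_nonneg.2 (gapExcess_convTime_le x hC0 N))
      (sub_le_sub_left (occupationTime_le_gapExcess hx one_half_pos le_rfl N) _)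
  · rintro h ε ⟨hε0, hε⟩
    have hC : 2 * Real.log 2 ≤ -(4 * Real.log ε) := by
      linarith [two_mul_log_two_le_neg_log hε0 hε, Real.log_nonneg one_le_two]
    refine isLittleO_id_of_isLittleO_comp_succ (occupationTime.monotoneOn_id_sub _)
      (fun t ht ↦ sub_nonneg.2 (occupationTime.le_self ht)) (tendsto_convTime hx) ?_
    have hsub := ((isTheta_convTime_sub_gapExcess hx hC).isBigO.comp_tendsto
      (tendsto_add_atTop_nat 1)).trans isBigO_natCast_succ
    refine (isBigO_of_le _ fun N ↦ ?_).trans_isLittleO (hsub.trans_isLittleO h)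
    have hN := (convTime_zero x).ge.trans (convTime_mono x (N + 1).zero_le)
    exact abs_le_abs_of_nonneg (sub_nonneg.2 (occupationTime.le_self hN))
      (sub_le_sub_left (gapExcess_le_occupationTime hx hε0 hε _) _)

theorem log_modifiedPartialQuotient_nonneg (hx : Irrational x) (ξ : ℝ) (k : ℕ) :
    0 ≤ Real.log (modifiedPartialQuotient x ξ (k + 1)) := by
  unfold modifiedPartialQuotient
  split_ifs
  · exact Real.log_nonneg (one_le_partialQuotient_succ hx k)
  · exact Real.log_one.ge

theorem log_modifiedPartialQuotient_le_max (hx : Irrational x) {ξ C : ℝ} (hξ : 0 < ξ)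
    (hC : C ≤ Real.log ξ) (k : ℕ) : Real.log (modifiedPartialQuotient x ξ (k + 1)) ≤
      max (convTime x (k + 1) - convTime x k - C) 0 := by
  unfold modifiedPartialQuotient
  split_ifs with h
  · have := Real.log_le_log hξ h.le
    exact le_max_of_le_left (by linarith [two_mul_log_le_convTime_sub hx k])
  · exact Real.log_one.trans_le (le_max_right _ _)

theorem max_le_two_mul_log_modifiedPartialQuotient (hx : Irrational x) {ξ : ℝ} (hξ : 1 ≤ ξ)
    (k : ℕ) :
    max (convTime x (k + 1) - convTime x k - (2 * Real.log ξ + 2 * Real.log 2)) 0 ≤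
      2 * Real.log (modifiedPartialQuotient x ξ (k + 1)) := by
  have hgap := convTime_sub_le hx k
  refine max_le ?_ (mul_nonneg zero_le_two (log_modifiedPartialQuotient_nonneg hx ξ k))
  unfold modifiedPartialQuotient
  split_ifs with h
  · linarith [Real.log_nonneg hξ]
  · have := Real.log_le_log (one_pos.trans_le (one_le_partialQuotient_succ hx k)) (not_lt.1 h)
    rw [Real.log_one]
    linarith

theorem tendsto_modifiedLogAverage_iff (x ξ : ℝ) :
    Tendsto (modifiedLogAverage x ξ) atTop (𝓝 0) ↔
      (fun N ↦ ∑ k ∈ range N, Real.log (modifiedPartialQuotient x ξ (k + 1))) =o[atTop]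
        fun N : ℕ ↦ (N : ℝ) := by
  rw [isLittleO_iff_tendsto' ((eventually_ne_atTop 0).mono fun N hN h ↦
    (hN (Nat.cast_eq_zero.1 h)).elim)]
  refine tendsto_congr fun N ↦ ?_
  rw [modifiedLogAverage, sum_Icc_one_eq_sum_range, one_div_mul_eq_div]

theorem tendsto_logAverage_iff (hx : Irrational x) :
    Tendsto (logAverage x) atTop atTop ↔ (fun N : ℕ ↦ (N : ℝ)) =o[atTop]
      fun N ↦ ∑ k ∈ range N, Real.log (partialQuotient x (k + 1)) := by
  rw [← tendsto_div_natCast_atTop_iff fun N ↦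
    sum_nonneg fun k _ ↦ Real.log_nonneg (one_le_partialQuotient_succ hx k)]
  refine tendsto_congr fun N ↦ ?_
  rw [logAverage, sum_Icc_one_eq_sum_range, one_div_mul_eq_div]

theorem exists_gapExcess_isLittleO_iff (hx : Irrational x) :
    (∃ C, gapExcess (convTime x) C =o[atTop] fun N : ℕ ↦ (N : ℝ)) ↔
      ∃ ξ : ℝ, 1 < ξ ∧ Tendsto (modifiedLogAverage x ξ) atTop (𝓝 0) := by
  simp only [tendsto_modifiedLogAverage_iff]
  constructor
  · rintro ⟨C, hC⟩
    refine ⟨Real.exp (max C 1), Real.one_lt_exp_iff.2 (by positivity),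
      (isBigO_of_le _ fun N ↦ ?_).trans_isLittleO hC⟩
    refine abs_le_abs_of_nonneg
      (sum_nonneg fun k _ ↦ log_modifiedPartialQuotient_nonneg hx _ k)
      (sum_le_sum fun k _ ↦ log_modifiedPartialQuotient_le_max hx (Real.exp_pos _) ?_ k)
    exact (le_max_left _ _).trans_eq (Real.log_exp _).symm
  · rintro ⟨ξ, hξ, h⟩
    refine ⟨2 * Real.log ξ + 2 * Real.log 2,
      (isBigO_of_le _ fun N ↦ ?_).trans_isLittleO (h.const_mul_left 2)⟩
    refine abs_le_abs_of_nonneg (gapExcess.nonneg _ _ N) ?_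
    rw [mul_sum]
    exact sum_le_sum fun k _ ↦ max_le_two_mul_log_modifiedPartialQuotient hx hξ.le k

theorem isLittleO_natCast_convTime_iff (hx : Irrational x) :
    (fun N : ℕ ↦ (N : ℝ)) =o[atTop] convTime x ↔ (fun N : ℕ ↦ (N : ℝ)) =o[atTop]
      fun N ↦ ∑ k ∈ range N, Real.log (partialQuotient x (k + 1)) := by
  set s : ℕ → ℝ := fun N ↦ ∑ k ∈ range N, Real.log (partialQuotient x (k + 1))
  have hsum (N : ℕ) : convTime x N = ∑ k ∈ range N, (convTime x (k + 1) - convTime x k) := by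
    rw [sum_range_sub, convTime_zero, sub_zero]
  have hs0 (N : ℕ) : 0 ≤ s N :=
    sum_nonneg fun k _ ↦ Real.log_nonneg (one_le_partialQuotient_succ hx k)
  have hlower (N : ℕ) : 2 * s N ≤ convTime x N := by
    rw [hsum, mul_sum]
    exact sum_le_sum fun k _ ↦ two_mul_log_le_convTime_sub hx k
  have hupper (N : ℕ) : convTime x N - 2 * s N ≤ 2 * Real.log 2 * N := by
    rw [hsum, mul_sum, ← sum_sub_distrib]
    refine (sum_le_card_nsmul _ _ (2 * Real.log 2) fun k _ ↦ ?_).trans_eq ?_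
    · exact sub_le_iff_le_add'.2 (convTime_sub_le hx k)
    · rw [card_range, nsmul_eq_mul, mul_comm]
  constructor <;> intro h
  · have hsub : (fun N ↦ convTime x N - 2 * s N) =O[atTop] fun N : ℕ ↦ (N : ℝ) :=
      .of_bound (2 * Real.log 2) (.of_forall fun N ↦ by
        rw [Real.norm_of_nonneg (sub_nonneg.2 (hlower N)), Real.norm_natCast]
        exact hupper N)
    have hconv := (hsub.trans_isLittleO h).right_isBigO_sub
    simp only [sub_sub_cancel] at hconv
    exact h.trans_isBigO (hconv.trans (isBigO_const_mul_self 2 s atTop))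
  · refine h.trans_isBigO (isBigO_of_le _ fun N ↦ abs_le_abs_of_nonneg (hs0 N) ?_)
    linarith [hs0 N, hlower N]

end Frequencies

/-- For irrational `x` the expansion is infinite and the two equivalences hold. For rational `x`
the expansion is finite (`a_j = ∞` from some `j` on, so that the averages become infinite): the
orbit visits the cusp with frequency one and not with frequency zero. -/
theorem theorem1p2 (x : ℝ) :
    (Irrational x →
      (VisitsCuspWithFrequencyZero x ↔
        ∃ ξ : ℝ, 1 < ξ ∧ Tendsto (modifiedLogAverage x ξ) atTop (𝓝 0)) ∧
      (VisitsCuspWithFrequencyOne x ↔ Tendsto (logAverage x) atTop atTop)) ∧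
    (¬ Irrational x →
      VisitsCuspWithFrequencyOne x ∧ ¬ VisitsCuspWithFrequencyZero x) := by
  constructor
  · intro hx
    refine ⟨?_, ?_⟩
    · rw [visitsCuspWithFrequencyZero_iff_gapExcess hx, exists_gapExcess_isLittleO_iff hx]
    · rw [visitsCuspWithFrequencyOne_iff_convTime hx, isLittleO_natCast_convTime_iff hx,
        tendsto_logAverage_iff hx]
  · intro hx
    obtain ⟨r, rfl⟩ := not_not.1 hx
    have hone := visitsCuspWithFrequencyOne_of_tendsto_cocompact (tendsto_cuspOrbit_ratCast r)
    exact ⟨hone, hone.not_frequencyZero⟩
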